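/- **Theorem 1.3.** For a partition $\lambda$ write $|\lambda|$ for the sum of its parts, $\ell(\lambda)$ for the number of its parts and $\lambda_1$ for its largest part ($\lambda_1=0$ if $\lambda$ is empty). Let $N(m;n)$ be the number of partitions $\lambda$ of $n$ with rank $\lambda_1-\ell(\lambda)=m$. Let $k\ge 2$. A $k$-marked Durfee symbol of $n$ is a two-row array with a subscript $$\eta=\begin{pmatrix}\alpha^k,&\alpha^{k-1},&\ldots,&\alpha^1\\ \beta^k,&\beta^{k-1},&\ldots,&\beta^1\end{pmatrix}_D ,$$ where $D\ge 0$ is an integer and the $\alpha^i,\beta^i$ are (possibly empty) partitions with $\sum_{i=1}^k(|\alpha^i|+|\beta^i|)+D^2=n$, such that 1. $\alpha^i$ is non-empty for $1\le i<k$; 2. for $1\le i<k$ one has $\beta^i_1\le\alpha^i_1$, and every part of $\alpha^{i+1}$ and every part of $\beta^{i+1}$ is at least $\alpha^i_1$; 3. every part of every $\alpha^i$ and $\beta^i$, $1\le i\le k$, is at most $D$. Its $i$th rank is $\rho_i(\eta)=\ell(\alpha^i)-\ell(\beta^i)-1$ for $1\le i<k$, and $\rho_k(\eta)=\ell(\alpha^k)-\ell(\beta^k)$.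 For integers $m_1,\dots,m_k$ and $n\ge 0$ let $\mathcal D_k(m_1,\dots,m_k;n)$ be the number of $k$-marked Durfee symbols $\eta$ of $n$ with $\rho_i(\eta)=m_i$ for all $1\le i\le k$. Then, for all integers $m_1,\dots,m_k$ and all $n\ge 0$, the number $\mathcal D_k(m_1,\dots,m_k;n)$ is finite and $$\mathcal D_k(m_1,\dots,m_k;n)=\sum_{j=0}^{\infty}\binom{j+k-2}{k-2}\,N\Bigl(\sum_{i=1}^k|m_i|+2j+k-1;\,n\Bigr),$$ where only finitely many terms of the sum are nonzero. -/

import Mathlib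

/-- The rank of a partition: its largest part minus its number of parts.
The empty partition (of `0`) has rank `0`. -/
def dysonRank {n : ℕ} (p : Nat.Partition n) : ℤ :=
  (p.parts.sup : ℤ) - (Multiset.card p.parts : ℤ)

/-- `rankCount m n` is `N(m; n)`, the number of partitions of `n` whose rank is `m`. -/
def rankCount (m : ℤ) (n : ℕ) : ℕ :=
  (Finset.univ.filter fun p : Nat.Partition n => dysonRank p = m).card

/-- A `k`-marked Durfee symbol
`(α^k, α^(k-1), …, α^1; β^k, β^(k-1), …, β^1)_D`.
Partitions are finite multisets of positive integers. The index set `Fin k` is zero-based: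
`top i` is the partition `α^(i+1)` and `bot i` is the partition `β^(i+1)`.
The largest part of a partition `s` is `s.sup` (equal to `0` when `s` is empty). -/
@[ext]
structure MarkedDurfeeSymbol (k : ℕ) where
  /-- the partitions of the top row -/
  top : Fin k → Multiset ℕ
  /-- the partitions of the bottom row -/
  bot : Fin k → Multiset ℕ
  /-- the subscript `D` -/
  D : ℕ
  top_pos : ∀ i, ∀ x ∈ top i, 0 < x
  bot_pos : ∀ i, ∀ x ∈ bot i, 0 < x
  /-- all the partitions of the top row, except possibly the `k`th one, are non-empty -/
  top_nonempty : ∀ i : Fin k, (i : ℕ) + 1 < k → top i ≠ 0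
  /-- except possibly in the `k`th vector, no part of `β^i` exceeds the largest part of `α^i` -/
  bot_le_top : ∀ i : Fin k, (i : ℕ) + 1 < k → (bot i).sup ≤ (top i).sup
  /-- every part of `β^(i+1)` is at least the largest part of `α^i` -/
  top_le_bot_succ : ∀ i j : Fin k, (j : ℕ) = (i : ℕ) + 1 → ∀ x ∈ bot j, (top i).sup ≤ x
  /-- every part of `α^(i+1)` is at least the largest part of `α^i`: the top row, read
  `α^k, …, α^1`, is nonincreasing -/
  top_le_top_succ : ∀ i j : Fin k, (j : ℕ) = (i : ℕ) + 1 → ∀ x ∈ top j, (top i).sup ≤ x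
  /-- no part exceeds `D` -/
  top_le_D : ∀ i, ∀ x ∈ top i, x ≤ D
  bot_le_D : ∀ i, ∀ x ∈ bot i, x ≤ D

/-- The number of which `η` is a `k`-marked Durfee symbol: the sum of all its parts plus `D²`. -/
def MarkedDurfeeSymbol.weight {k : ℕ} (η : MarkedDurfeeSymbol k) : ℕ :=
  (∑ i, ((η.top i).sum + (η.bot i).sum)) + η.D ^ 2

/-- The ranks of a `k`-marked Durfee symbol: `ℓ(α^i) - ℓ(β^i) - 1` for `i < k` and
`ℓ(α^k) - ℓ(β^k)` for `i = k` (in the zero-based index, `i + 1 < k` and `i + 1 = k`). -/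
def MarkedDurfeeSymbol.rank {k : ℕ} (η : MarkedDurfeeSymbol k) (i : Fin k) : ℤ :=
  (Multiset.card (η.top i) : ℤ) - (Multiset.card (η.bot i) : ℤ) -
    (if (i : ℕ) + 1 < k then 1 else 0)

/-- The set of `k`-marked Durfee symbols of `n` whose `i`th rank is `m i` for every `i`. -/
def markedDurfeeSymbols (k : ℕ) (m : Fin k → ℤ) (n : ℕ) : Set (MarkedDurfeeSymbol k) :=
  {η | η.weight = n ∧ ∀ i, η.rank i = m i}

/-! Fix the Durfee side `D`. Cutting a partition along its Durfee square and conjugating the piece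
to the right turns it into a pair of partitions with parts in `[1, D]`, whose rank is the difference
of the numbers of parts (`rankCount_eq_sum`). In a marked symbol, setting aside one copy of the
largest part `M` of the first top partition absorbs the `-1` in the first rank. This leaves a free
pair with parts in `[1, M]` and a shorter chain with parts in `[M, D]` (`hasGenFun_markedChains`).
Both sides of the theorem thus become identities of power series for each `D`.

The core is the case of two vectors with ranks `a` and `b`: their series is the sum over `j` of the
one-vector series at rank `|a| + |b| + 2j + 1` (`X_pow_dvd_mergeSeries_sub`). Both sides satisfy the
same inhomogeneous discrete wave equation in `(a, b)` (`mergeSeries_wave`, `oddTail_wave`). Modulo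
`X ^ N` both vanish once `a ≥ N`, so descending induction on `a` identifies them.

Merging the first two vectors repeatedly reduces a chain to a single vector; the nested sums collect
into binomial coefficients by the hockey-stick identity (`chainSeries_eq`). Infinite sums over `j`
are avoided by working modulo `X ^ N`. -/

open PowerSeries

/-! ### Generating functions of weighted sets -/

/-- `p` is the generating function of the elements of `s` counted by the weight `w`; in particular
only finitely many elements of `s` have a given weight. -/
def HasGenFun {ι : Type*} (s : Set ι) (w : ι → ℕ) (p : PowerSeries ℤ) : Prop :=
  ∀ n, {x ∈ s | w x = n}.Finite ∧ coeff n p = ({x ∈ s | w x = n}.ncard : ℤ)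

namespace HasGenFun

variable {ι κ : Type*} {s : Set ι} {t : Set κ} {w : ι → ℕ} {v : κ → ℕ} {p q : PowerSeries ℤ}

theorem of_finite (h : ∀ n, {x ∈ s | w x = n}.Finite) :
    HasGenFun s w (PowerSeries.mk fun n => ({x ∈ s | w x = n}.ncard : ℤ)) :=
  fun n => ⟨h n, by simp⟩

theorem unique (hp : HasGenFun s w p) (hq : HasGenFun s w q) : p = q := by
  ext n
  rw [(hp n).2, (hq n).2]

theorem bijOn (hp : HasGenFun s w p) {f : ι → κ} (hf : Set.BijOn f s t) (c : ℕ)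
    (hw : ∀ x ∈ s, v (f x) = w x + c) : HasGenFun t v (X ^ c * p) := by
  intro n
  rw [coeff_X_pow_mul']
  split_ifs with hc
  · have himage : {y ∈ t | v y = n} = f '' {x ∈ s | w x = n - c} := by
      ext y
      constructor
      · rintro ⟨hy, hv⟩
        obtain ⟨x, hx, rfl⟩ := hf.surjOn hy
        have := hw x hx
        exact ⟨x, ⟨hx, by omega⟩, rfl⟩
      · rintro ⟨x, ⟨hx, hxw⟩, rfl⟩
        have := hw x hx
        exact ⟨hf.mapsTo hx, by omega⟩
    rw [himage, (hf.injOn.mono (Set.sep_subset _ _)).ncard_image]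
    exact ⟨(hp _).1.image f, (hp _).2⟩
  · have hempty : {y ∈ t | v y = n} = ∅ := by
      refine Set.eq_empty_of_forall_notMem ?_
      rintro y ⟨hy, hv⟩
      obtain ⟨x, hx, rfl⟩ := hf.surjOn hy
      have := hw x hx
      omega
    simp [hempty]

theorem union {t : Set ι} (hp : HasGenFun s w p) (hq : HasGenFun t w q) (h : Disjoint s t) :
    HasGenFun (s ∪ t) w (p + q) := by
  intro n
  have hunion : {x ∈ s ∪ t | w x = n} = {x ∈ s | w x = n} ∪ {x ∈ t | w x = n} := by
    ext x
    simp only [Set.mem_ofPred_eq, Set.mem_union]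
    tauto
  rw [hunion, Set.ncard_union_eq (h.mono (Set.sep_subset _ _) (Set.sep_subset _ _)) (hp n).1
    (hq n).1, map_add, (hp n).2, (hq n).2]
  exact ⟨(hp n).1.union (hq n).1, by push_cast; rfl⟩

theorem empty : HasGenFun (∅ : Set ι) w 0 := fun n => by simp

theorem sum_fiber {γ : Type*} [DecidableEq γ] (I : Finset γ) (f : ι → γ) (P : γ → PowerSeries ℤ)
    (h : ∀ i ∈ I, HasGenFun {x ∈ s | f x = i} w (P i)) :
    HasGenFun {x ∈ s | f x ∈ I} w (∑ i ∈ I, P i) := by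
  induction I using Finset.induction_on with
  | empty => simpa using empty
  | insert a I ha ih =>
    rw [Finset.sum_insert ha]
    have hunion : {x ∈ s | f x ∈ insert a I} = {x ∈ s | f x = a} ∪ {x ∈ s | f x ∈ I} := by
      ext x
      simp only [Set.mem_ofPred_eq, Set.mem_union, Finset.mem_insert]
      tauto
    rw [hunion]
    refine (h a (by simp)).union (ih fun i hi => h i (by simp [hi])) ?_
    rw [Set.disjoint_left]
    rintro x ⟨-, hx⟩ ⟨-, hx'⟩
    exact ha (hx ▸ hx')

theorem prod (hp : HasGenFun s w p) (hq : HasGenFun t v q) :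
    HasGenFun (s ×ˢ t) (fun z => w z.1 + v z.2) (p * q) := by
  classical
  intro n
  have hset : {z ∈ s ×ˢ t | w z.1 + v z.2 = n} = (((Finset.HasAntidiagonal.antidiagonal n).biUnion fun ij =>
      (hp ij.1).1.toFinset ×ˢ (hq ij.2).1.toFinset : Finset (ι × κ)) : Set (ι × κ)) := by
    ext ⟨x, y⟩
    simp only [Set.mem_ofPred_eq, Set.mem_prod, Finset.coe_biUnion, Finset.mem_coe,
      Finset.HasAntidiagonal.mem_antidiagonal, Finset.coe_product, Set.Finite.coe_toFinset, Set.mem_iUnion,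
      exists_prop, Prod.exists]
    constructor
    · rintro ⟨⟨hx, hy⟩, h⟩
      exact ⟨_, _, h, ⟨hx, rfl⟩, hy, rfl⟩
    · rintro ⟨i, j, h, ⟨hx, rfl⟩, hy, rfl⟩
      exact ⟨⟨hx, hy⟩, h⟩
  rw [hset, Set.ncard_coe_finset, Finset.card_biUnion, coeff_mul]
  · refine ⟨Finset.finite_toSet _, ?_⟩
    push_cast
    refine Finset.sum_congr rfl fun ij _ => ?_
    rw [Finset.card_product, ← Set.ncard_eq_toFinset_card _ (hp _).1,
      ← Set.ncard_eq_toFinset_card _ (hq _).1, Nat.cast_mul, ← (hp _).2, ← (hq _).2]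
  · rintro ⟨i, j⟩ _ ⟨i', j'⟩ _ hne
    simp only [Function.onFun]
    rw [Finset.disjoint_left]
    rintro ⟨x, y⟩ h h'
    simp only [Finset.mem_product, Set.Finite.mem_toFinset, Set.mem_ofPred_eq] at h h'
    exact hne (by rw [← h.1.2, ← h.2.2, h'.1.2, h'.2.2])

/-- Elements of a family of weighted sets, the `d`th one shifted by `d ^ 2`. -/
theorem sigma_sq {S : ℕ → Set ι} {P : ℕ → PowerSeries ℤ} (h : ∀ d, HasGenFun (S d) w (P d)) (n : ℕ) :
    {z : ℕ × ι | z.2 ∈ S z.1 ∧ w z.2 + z.1 ^ 2 = n}.Finite ∧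
      ({z : ℕ × ι | z.2 ∈ S z.1 ∧ w z.2 + z.1 ^ 2 = n}.ncard : ℤ) =
        ∑ d ∈ Finset.range (n + 1), coeff n (X ^ (d ^ 2) * P d) := by
  have key : HasGenFun {z ∈ {z : ℕ × ι | z.2 ∈ S z.1} | z.1 ∈ Finset.range (n + 1)}
      (fun z => w z.2 + z.1 ^ 2) (∑ d ∈ Finset.range (n + 1), X ^ (d ^ 2) * P d) := by
    refine sum_fiber _ _ _ fun d _ => (h d).bijOn (f := fun x => (d, x)) ⟨?_, ?_, ?_⟩ _ ?_
    · intro x hx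
      exact ⟨hx, rfl⟩
    · intro x _ y _ hxy
      exact (Prod.ext_iff.1 hxy).2
    · rintro ⟨d', x⟩ ⟨hx, rfl⟩
      exact ⟨x, hx, rfl⟩
    · simp
  have hset : {z : ℕ × ι | z.2 ∈ S z.1 ∧ w z.2 + z.1 ^ 2 = n} =
      {x ∈ {z ∈ {z : ℕ × ι | z.2 ∈ S z.1} | z.1 ∈ Finset.range (n + 1)} |
        w x.2 + x.1 ^ 2 = n} := by
    ext ⟨d, x⟩
    simp only [Set.mem_ofPred_eq, Finset.mem_range]
    constructor
    · rintro ⟨hx, hw⟩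
      -- The range is large enough because `d ≤ d ^ 2 ≤ n`.
      exact ⟨⟨hx, by nlinarith⟩, hw⟩
    · rintro ⟨⟨hx, -⟩, hw⟩
      exact ⟨hx, hw⟩
  rw [hset, ← (key n).2, map_sum]
  exact ⟨(key n).1, rfl⟩

end HasGenFun

/-! ### Pairs of partitions with a given difference of lengths -/

/-- Pairs of partitions with parts in `A` and `B`, whose numbers of parts differ by `m`. -/
def partitionPairs (A B : Finset ℕ) (m : ℤ) : Set (Multiset ℕ × Multiset ℕ) :=
  {p | (∀ x ∈ p.1, x ∈ A) ∧ (∀ x ∈ p.2, x ∈ B) ∧ (p.1.card : ℤ) - p.2.card = m}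

/-- The sum of all parts of a pair of partitions. -/
def pairWeight (p : Multiset ℕ × Multiset ℕ) : ℕ := p.1.sum + p.2.sum

/-- The generating function of `partitionPairs A B m`. -/
noncomputable def pairSeries (A B : Finset ℕ) (m : ℤ) : PowerSeries ℤ :=
  PowerSeries.mk fun n => ({p ∈ partitionPairs A B m | pairWeight p = n}.ncard : ℤ)

theorem Multiset.finite_setOf_sum_le (n : ℕ) :
    {s : Multiset ℕ | (∀ x ∈ s, 0 < x) ∧ s.sum ≤ n}.Finite := by
  refine Set.Finite.subset (Set.Finite.biUnion (Set.finite_Iic n) fun k _ =>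
    Set.finite_range fun p : Nat.Partition k => p.parts) ?_
  rintro s ⟨hpos, hsum⟩
  simp only [Set.mem_iUnion]
  exact ⟨s.sum, hsum, ⟨s, fun {i} hi => hpos i hi, rfl⟩, rfl⟩

theorem Multiset.card_le_sum_of_pos {s : Multiset ℕ} (h : ∀ x ∈ s, 0 < x) : s.card ≤ s.sum := by
  have := Multiset.card_nsmul_le_sum (s := s) (a := 1) fun x hx => h x hx
  simpa using this

section pairSeries

variable {A B : Finset ℕ} {j : ℕ}

theorem hasGenFun_pairSeries (hA : 0 ∉ A) (hB : 0 ∉ B) (m : ℤ) :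
    HasGenFun (partitionPairs A B m) pairWeight (pairSeries A B m) := by
  refine HasGenFun.of_finite fun n => Set.Finite.subset
    ((Multiset.finite_setOf_sum_le n).prod (Multiset.finite_setOf_sum_le n)) ?_
  rintro ⟨α, β⟩ ⟨⟨hα, hβ, -⟩, hw⟩
  simp only [pairWeight] at hw
  exact ⟨⟨fun x hx => Nat.pos_of_ne_zero fun h => hA (h ▸ hα x hx), by simp; omega⟩,
    ⟨fun x hx => Nat.pos_of_ne_zero fun h => hB (h ▸ hβ x hx), by simp; omega⟩⟩

theorem pairSeries_swap (hA : 0 ∉ A) (hB : 0 ∉ B) (m : ℤ) :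
    pairSeries B A (-m) = pairSeries A B m := by
  refine HasGenFun.unique (hasGenFun_pairSeries hB hA _) ?_
  have := (hasGenFun_pairSeries hA hB m).bijOn (f := Prod.swap) (t := partitionPairs B A (-m))
    (v := pairWeight) ⟨?_, Prod.swap_injective.injOn, ?_⟩ 0 ?_
  · simpa using this
  · rintro ⟨α, β⟩ ⟨h1, h2, h3⟩
    refine ⟨h2, h1, ?_⟩
    simp only [Prod.fst_swap, Prod.snd_swap] at h3 ⊢
    omega
  · rintro ⟨α, β⟩ ⟨h1, h2, h3⟩
    refine ⟨(β, α), ⟨h2, h1, ?_⟩, rfl⟩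
    simp only at h3 ⊢
    omega
  · rintro ⟨α, β⟩ _
    simp [pairWeight, add_comm]

/-- Either `j` does not occur on the left, or one copy of it can be removed, which costs `X ^ j` and
lowers the difference by one. -/
theorem pairSeries_insert_left (hA : 0 ∉ A) (hB : 0 ∉ B) (hj : 0 < j) (hjA : j ∉ A) (m : ℤ) :
    pairSeries (insert j A) B m =
      pairSeries A B m + X ^ j * pairSeries (insert j A) B (m - 1) := by
  have hjA0 : 0 ∉ insert j A := by simp [hA, hj.ne]
  refine HasGenFun.unique (hasGenFun_pairSeries hjA0 hB _) ?_
  have h1 := hasGenFun_pairSeries hA hB m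
  have h2 := (hasGenFun_pairSeries hjA0 hB (m - 1)).bijOn
    (f := fun p : Multiset ℕ × Multiset ℕ => (j ::ₘ p.1, p.2))
    (t := {p ∈ partitionPairs (insert j A) B m | j ∈ p.1}) (v := pairWeight) ⟨?_, ?_, ?_⟩ j ?_
  · convert h1.union h2 ?_ using 1
    · ext ⟨α, β⟩
      simp only [partitionPairs, Set.mem_union, Set.mem_ofPred_eq]
      constructor
      · rintro ⟨h1, h2, h3⟩
        by_cases hj : j ∈ α
        · exact Or.inr ⟨⟨h1, h2, h3⟩, hj⟩
        · refine Or.inl ⟨fun x hx => ?_, h2, h3⟩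
          exact Finset.mem_of_mem_insert_of_ne (h1 x hx) fun h => hj (h ▸ hx)
      · rintro (⟨h1, h2, h3⟩ | ⟨h, -⟩)
        · exact ⟨fun x hx => Finset.mem_insert_of_mem (h1 x hx), h2, h3⟩
        · exact h
    · rw [Set.disjoint_left]
      rintro ⟨α, β⟩ ⟨h, -⟩ ⟨-, h'⟩
      exact hjA (h j h')
  · rintro ⟨α, β⟩ ⟨h1, h2, h3⟩
    refine ⟨⟨?_, h2, ?_⟩, by simp⟩
    · simpa using h1
    · simp only [Multiset.card_cons] at h3 ⊢
      push_cast
      omega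
  · rintro ⟨α, β⟩ _ ⟨α', β'⟩ _ h
    simpa using h
  · rintro ⟨α, β⟩ ⟨⟨h1, h2, h3⟩, hj⟩
    obtain ⟨α, rfl⟩ := Multiset.exists_cons_of_mem hj
    refine ⟨(α, β), ⟨fun x hx => h1 x (by simp [hx]), h2, ?_⟩, rfl⟩
    simp only [Multiset.card_cons] at h3 ⊢
    push_cast at h3
    omega
  · rintro ⟨α, β⟩ _
    simp [pairWeight]
    ring

theorem pairSeries_insert_right (hA : 0 ∉ A) (hB : 0 ∉ B) (hj : 0 < j) (hjB : j ∉ B) (m : ℤ) :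
    pairSeries A (insert j B) m =
      pairSeries A B m + X ^ j * pairSeries A (insert j B) (m + 1) := by
  have hjB0 : 0 ∉ insert j B := by simp [hB, hj.ne]
  rw [← pairSeries_swap hA hjB0, ← pairSeries_swap hA hB, ← pairSeries_swap hA hjB0,
    pairSeries_insert_left hB hA hj hjB, neg_add, sub_eq_add_neg]

/-- Multiplication of the two-variable generating function by `(1 - z q ^ j) (1 - z⁻¹ q ^ j)`. -/
theorem pairSeries_insert (hA : 0 ∉ A) (hj : 0 < j) (hjA : j ∉ A) (m : ℤ) :
    pairSeries A A m = (1 + X ^ j * X ^ j) * pairSeries (insert j A) (insert j A) m -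
      X ^ j * (pairSeries (insert j A) (insert j A) (m - 1) +
        pairSeries (insert j A) (insert j A) (m + 1)) := by
  have hjA0 : 0 ∉ insert j A := by simp [hA, hj.ne]
  have h1 := pairSeries_insert_right hA hA hj hjA m
  have h2 := pairSeries_insert_left hA hjA0 hj hjA m
  have h3 := pairSeries_insert_left hA hjA0 hj hjA (m + 1)
  rw [add_sub_cancel_right] at h3
  linear_combination -h1 - h2 + X ^ j * h3

/-- All parts are at least 1, so the weight is at least the total number of parts, hence at least
`|m|`. This is what permits truncating sums over ranks modulo `X ^ N`. -/
theorem X_pow_dvd_pairSeries (hA : 0 ∉ A) (hB : 0 ∉ B) {m : ℤ} {N : ℕ} (hN : (N : ℤ) ≤ |m|) :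
    (X : PowerSeries ℤ) ^ N ∣ pairSeries A B m := by
  rw [X_pow_dvd_iff]
  intro n hn
  have hempty : {p ∈ partitionPairs A B m | pairWeight p = n} = ∅ := by
    refine Set.eq_empty_of_forall_notMem ?_
    rintro ⟨α, β⟩ ⟨⟨h1, h2, h3⟩, hw⟩
    have ha := Multiset.card_le_sum_of_pos fun x hx =>
      Nat.pos_of_ne_zero fun h => hA (h ▸ h1 x hx)
    have hb := Multiset.card_le_sum_of_pos fun x hx =>
      Nat.pos_of_ne_zero fun h => hB (h ▸ h2 x hx)
    simp only [pairWeight] at *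
    rcases abs_cases m with h | h <;> omega
  simp [pairSeries, hempty]

theorem pairSeries_empty (m : ℤ) : pairSeries ∅ ∅ m = if m = 0 then 1 else 0 := by
  refine HasGenFun.unique (hasGenFun_pairSeries (by simp) (by simp) m) fun n => ?_
  have hset : {p ∈ partitionPairs ∅ ∅ m | pairWeight p = n} =
      if m = 0 ∧ n = 0 then {(0, 0)} else ∅ := by
    ext ⟨α, β⟩
    constructor
    · rintro ⟨⟨h1, h2, h3⟩, hw⟩
      have hα := Multiset.eq_zero_of_forall_notMem fun x hx => Finset.notMem_empty x (h1 x hx)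
      have hβ := Multiset.eq_zero_of_forall_notMem fun x hx => Finset.notMem_empty x (h2 x hx)
      simp only at hα hβ
      subst hα hβ
      simp only [pairWeight, Multiset.card_zero, Multiset.sum_zero] at h3 hw
      rw [if_pos ⟨by simpa using h3.symm, by simpa using hw.symm⟩]
      rfl
    · split_ifs with h
      · rintro h'
        obtain ⟨rfl, rfl⟩ := Prod.ext_iff.1 h'
        simp [partitionPairs, pairWeight, h.1, h.2]
      · simp
  rw [hset]
  by_cases hm : m = 0 <;> by_cases hn : n = 0 <;> simp [hm, hn, coeff_one]

end pairSeries

/-! ### Pairs with parts in an interval -/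

/-- The generating function of pairs of partitions with parts in `[L, D)`, whose numbers of parts
differ by `m`. -/
noncomputable def intervalSeries (L D : ℕ) (m : ℤ) : PowerSeries ℤ :=
  pairSeries (Finset.Ico L D) (Finset.Ico L D) m

section intervalSeries

variable {L D : ℕ}

theorem intervalSeries_neg (hL : 0 < L) (m : ℤ) :
    intervalSeries L D (-m) = intervalSeries L D m :=
  pairSeries_swap (by simp; omega) (by simp; omega) m

theorem intervalSeries_abs (hL : 0 < L) (m : ℤ) :
    intervalSeries L D |m| = intervalSeries L D m := by
  rcases abs_choice m with h | h <;> rw [h]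
  exact intervalSeries_neg hL m

theorem intervalSeries_self (m : ℤ) : intervalSeries L L m = if m = 0 then 1 else 0 := by
  rw [intervalSeries, Finset.Ico_self, pairSeries_empty]

theorem X_pow_dvd_intervalSeries (hL : 0 < L) {m : ℤ} {N : ℕ} (hN : (N : ℤ) ≤ |m|) :
    (X : PowerSeries ℤ) ^ N ∣ intervalSeries L D m :=
  X_pow_dvd_pairSeries (by simp; omega) (by simp; omega) hN

theorem intervalSeries_succ_right (hL : 0 < L) (hLD : L ≤ D) (m : ℤ) :
    intervalSeries L D m = (1 + X ^ D * X ^ D) * intervalSeries L (D + 1) m -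
      X ^ D * (intervalSeries L (D + 1) (m - 1) + intervalSeries L (D + 1) (m + 1)) := by
  have h : Finset.Ico L (D + 1) = insert D (Finset.Ico L D) := by
    ext x
    simp only [Finset.mem_Ico, Finset.mem_insert]
    omega
  simp only [intervalSeries, h]
  exact pairSeries_insert (by simp; omega) (by omega) (by simp) m

theorem intervalSeries_succ_left (hL : 0 < L) (hLD : L < D) (m : ℤ) :
    intervalSeries (L + 1) D m = (1 + X ^ L * X ^ L) * intervalSeries L D m -
      X ^ L * (intervalSeries L D (m - 1) + intervalSeries L D (m + 1)) := by
  have h : Finset.Ico L D = insert L (Finset.Ico (L + 1) D) := by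
    ext x
    simp only [Finset.mem_Ico, Finset.mem_insert]
    omega
  simp only [intervalSeries, h]
  exact pairSeries_insert (by simp) hL (by simp) m

end intervalSeries

/-! ### Merging two consecutive vectors -/

/-- The generating function of two consecutive vectors with ranks `a` and `b` of a marked Durfee
symbol, all of whose parts lie in `[L, D)`. -/
noncomputable def mergeSeries (L D : ℕ) (a b : ℤ) : PowerSeries ℤ :=
  ∑ M ∈ Finset.Ico L D, X ^ M * (intervalSeries L (M + 1) a * intervalSeries M D b)

section mergeSeries

variable {L D : ℕ}

/-- The right side telescopes over the cut point `M`. Moving `M` to the next interval multiplies one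
factor and divides the other by the same kind of product `(1 - z q ^ M) (1 - z⁻¹ q ^ M)`; in the
difference the `1 + X ^ M * X ^ M` terms cancel and only rank shifts by one survive. -/
theorem mergeSeries_wave (hL : 0 < L) (hLD : L ≤ D) (a b : ℤ) :
    mergeSeries L D (a - 1) b + mergeSeries L D (a + 1) b -
        mergeSeries L D a (b - 1) - mergeSeries L D a (b + 1) =
      intervalSeries L D a * intervalSeries D D b - intervalSeries L L a * intervalSeries L D b := by
  rw [← Finset.sum_Ico_sub (fun M => intervalSeries L M a * intervalSeries M D b) hLD]
  simp only [mergeSeries, ← Finset.sum_add_distrib, ← Finset.sum_sub_distrib]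
  refine Finset.sum_congr rfl fun M hM => ?_
  rw [Finset.mem_Ico] at hM
  rw [intervalSeries_succ_right hL hM.1 a, intervalSeries_succ_left (by omega) hM.2 b]
  ring

theorem X_pow_dvd_mergeSeries (hL : 0 < L) {a : ℤ} (b : ℤ) {N : ℕ} (hN : (N : ℤ) ≤ |a|) :
    (X : PowerSeries ℤ) ^ N ∣ mergeSeries L D a b :=
  Finset.dvd_sum fun _ _ => ((X_pow_dvd_intervalSeries hL hN).mul_right _).mul_left _

/-- A partial sum of `∑ j, intervalSeries L D (c + 2 * j + 1)`. -/
noncomputable def oddTail (L D N : ℕ) (c : ℤ) : PowerSeries ℤ :=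
  ∑ j ∈ Finset.range N, intervalSeries L D (c + 2 * j + 1)

theorem oddTail_sub (N : ℕ) (c : ℤ) :
    oddTail L D N (c - 1) - oddTail L D N (c + 1) =
      intervalSeries L D c - intervalSeries L D (c + 2 * N) := by
  have h := Finset.sum_range_sub' (fun j : ℕ => intervalSeries L D (c + 2 * j)) N
  simp only [oddTail, ← Finset.sum_sub_distrib]
  rw [Nat.cast_zero, mul_zero, add_zero] at h
  rw [← h]
  refine Finset.sum_congr rfl fun j _ => ?_
  congr 2 <;> push_cast <;> ring

theorem X_pow_dvd_oddTail (hL : 0 < L) {c : ℤ} {N M : ℕ} (hN : (N : ℤ) ≤ c) :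
    (X : PowerSeries ℤ) ^ N ∣ oddTail L D M c :=
  Finset.dvd_sum fun j _ => X_pow_dvd_intervalSeries hL (le_trans (by omega) (le_abs_self _))

/-- A function of `|a| + |b|` solves the homogeneous wave equation off the axes. On one axis away
from the origin the kink of the absolute value leaves a telescoping difference, which is the source
term up to a remainder of high order; at the origin everything cancels. -/
theorem oddTail_wave (hL : 0 < L) (N : ℕ) (a b : ℤ) :
    (X : PowerSeries ℤ) ^ N ∣
      oddTail L D N (|a - 1| + |b|) + oddTail L D N (|a + 1| + |b|) -
        oddTail L D N (|a| + |b - 1|) - oddTail L D N (|a| + |b + 1|) -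
      (intervalSeries L D a * intervalSeries D D b -
        intervalSeries L L a * intervalSeries L D b) := by
  have hdvd : ∀ c : ℤ, (X : PowerSeries ℤ) ^ N ∣ intervalSeries L D (|c| + 2 * N) := fun c =>
    X_pow_dvd_intervalSeries hL (by have := abs_nonneg c; rw [abs_of_nonneg] <;> omega)
  have hshift : ∀ c : ℤ, c ≠ 0 → ∀ u : ℤ → PowerSeries ℤ,
      u |c - 1| + u |c + 1| = u (|c| - 1) + u (|c| + 1) := by
    intro c hc u
    rcases lt_or_gt_of_ne hc with h | h
    · rw [abs_of_neg h, abs_of_nonpos (by omega : c - 1 ≤ 0), abs_of_nonpos (by omega : c + 1 ≤ 0),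
        add_comm, show -(c + 1) = -c - 1 by ring, show -(c - 1) = -c + 1 by ring]
    · rw [abs_of_pos h, abs_of_nonneg (by omega : 0 ≤ c - 1), abs_of_pos (by omega : 0 < c + 1)]
  rw [intervalSeries_self, intervalSeries_self]
  by_cases ha : a = 0 <;> by_cases hb : b = 0
  · subst ha hb
    simp
  · subst ha
    have h := hshift b hb fun c => oddTail L D N c
    have h' := oddTail_sub (L := L) (D := D) N |b|
    simp only [zero_sub, abs_neg, abs_one, zero_add, abs_zero, if_pos, if_neg hb] at h ⊢
    rw [add_comm 1 |b|, ← intervalSeries_abs hL b]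
    convert hdvd b using 1
    linear_combination -h - h'
  · subst hb
    have h := hshift a ha fun c => oddTail L D N c
    have h' := oddTail_sub (L := L) (D := D) N |a|
    simp only [zero_sub, abs_neg, abs_one, zero_add, abs_zero, if_pos, if_neg ha, add_zero] at h ⊢
    rw [← intervalSeries_abs hL a, ← dvd_neg]
    convert hdvd a using 1
    linear_combination -h - h'
  · have h := hshift a ha fun c => oddTail L D N (c + |b|)
    have h' := hshift b hb fun c => oddTail L D N (|a| + c)
    simp only [if_neg ha, if_neg hb] at h h' ⊢
    convert dvd_zero _ using 1
    rw [show |a| - 1 + |b| = |a| + (|b| - 1) by ring, show |a| + 1 + |b| = |a| + (|b| + 1) by ring]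
      at h
    linear_combination h - h'

/-- The rank generating function of two consecutive vectors is a divided difference of that of a
single vector. -/
theorem X_pow_dvd_mergeSeries_sub (hL : 0 < L) (hLD : L ≤ D) (N : ℕ) (a b : ℤ) :
    (X : PowerSeries ℤ) ^ N ∣ mergeSeries L D a b - oddTail L D N (|a| + |b|) := by
  -- Induction on a bound for `N - a`: the wave equation centred at `(a + 1, b)` expresses the value
  -- at `(a, b)` through values with larger first rank.
  suffices h : ∀ (i : ℕ) (a b : ℤ), (N : ℤ) - a ≤ i →
      (X : PowerSeries ℤ) ^ N ∣ mergeSeries L D a b - oddTail L D N (|a| + |b|) from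
    h ((N : ℤ) - a).toNat a b (Int.self_le_toNat _)
  intro i
  induction i using Nat.strong_induction_on with
  | _ i ih =>
    intro a b hi
    by_cases haN : (N : ℤ) ≤ a
    · have := le_abs_self a
      have := abs_nonneg b
      exact dvd_sub (X_pow_dvd_mergeSeries hL b (by omega)) (X_pow_dvd_oddTail hL (by omega))
    · have hw := oddTail_wave (D := D) hL N (a + 1) b
      rw [← mergeSeries_wave hL hLD] at hw
      have h1 := ih (i - 1) (by omega) (a + 1) (b - 1) (by omega)
      have h2 := ih (i - 1) (by omega) (a + 1) (b + 1) (by omega)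
      have h3 : (X : PowerSeries ℤ) ^ N ∣
          mergeSeries L D (a + 1 + 1) b - oddTail L D N (|a + 1 + 1| + |b|) := by
        by_cases h : i = 1
        · have := le_abs_self (a + 1 + 1)
          have := abs_nonneg b
          exact dvd_sub (X_pow_dvd_mergeSeries hL b (by omega)) (X_pow_dvd_oddTail hL (by omega))
        · exact ih (i - 2) (by omega) _ _ (by omega)
      have h := ((dvd_add h1 h2).sub hw).sub h3
      rw [add_sub_cancel_right] at h
      convert h using 1
      ring

end mergeSeries

/-! ### Chains of vectors -/

/-- The generating function of sequences of `k + 1` consecutive vectors with ranks `m i` of a marked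
Durfee symbol, all of whose parts lie in `[L, D)`. -/
noncomputable def chainSeries (D : ℕ) : (k : ℕ) → ℕ → (Fin (k + 1) → ℤ) → PowerSeries ℤ
  | 0, L, m => intervalSeries L D (m 0)
  | k + 1, L, m => ∑ M ∈ Finset.Ico L D,
      X ^ M * (intervalSeries L (M + 1) (m 0) * chainSeries D k M (Fin.tail m))

/-- Exchanging the sums over the first two maxima puts the second one outside; the inner sum is then
`mergeSeries` with that maximum as upper limit, and the rest of the chain is a common factor. -/
theorem chainSeries_merge (D N k : ℕ) {L : ℕ} (hL : 0 < L) (hLD : L ≤ D) (m : Fin (k + 2) → ℤ) :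
    (X : PowerSeries ℤ) ^ N ∣ chainSeries D (k + 1) L m - ∑ j ∈ Finset.range N,
      chainSeries D k L (Fin.cons (|m 0| + |m 1| + 2 * j + 1) (Fin.tail (Fin.tail m))) := by
  cases k with
  | zero => simpa [chainSeries, mergeSeries, oddTail, Fin.tail] using
      X_pow_dvd_mergeSeries_sub hL hLD N (m 0) (m 1)
  | succ k =>
    have h : chainSeries D (k + 2) L m - ∑ j ∈ Finset.range N,
          chainSeries D (k + 1) L (Fin.cons (|m 0| + |m 1| + 2 * j + 1) (Fin.tail (Fin.tail m))) =
        ∑ M ∈ Finset.Ico L D, X ^ M * (chainSeries D k M (Fin.tail (Fin.tail m)) *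
          (mergeSeries L (M + 1) (m 0) (m 1) - oddTail L (M + 1) N (|m 0| + |m 1|))) := by
      simp only [chainSeries, Fin.cons_zero, Fin.tail_cons, mergeSeries, oddTail, mul_sub,
        Finset.sum_sub_distrib, Finset.mul_sum]
      congr 1
      · rw [Finset.sum_sigma', Finset.sum_sigma']
        refine Finset.sum_bij' (fun x _ => ⟨x.2, x.1⟩) (fun x _ => ⟨x.2, x.1⟩) ?_ ?_ ?_ ?_ ?_
        · rintro ⟨x, y⟩ h
          simp only [Finset.mem_sigma, Finset.mem_Ico] at h ⊢
          omega
        · rintro ⟨x, y⟩ h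
          simp only [Finset.mem_sigma, Finset.mem_Ico] at h ⊢
          omega
        · simp
        · simp
        · rintro ⟨x, y⟩ h
          simp only [Fin.tail, Fin.succ_zero_eq_one]
          ring
      · rw [Finset.sum_comm]
        refine Finset.sum_congr rfl fun M _ => Finset.sum_congr rfl fun j _ => ?_
        ring
    rw [h]
    refine Finset.dvd_sum fun M hM => ((X_pow_dvd_mergeSeries_sub hL ?_ N _ _).mul_left _).mul_left _
    rw [Finset.mem_Ico] at hM
    omega

/-- Group the double sum by `j + i`: below `N` the hockey-stick identity sums the coefficients, and
the terms with `j + i ≥ N` are divisible by `x`. -/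
theorem sum_range_mul_choose_mod {R : Type*} [CommRing R] (x : R) (k N : ℕ) (f : ℕ → R)
    (hf : ∀ i, N ≤ i → x ∣ f i) :
    x ∣ ∑ j ∈ Finset.range N, ∑ i ∈ Finset.range N, ((i + k).choose k : R) * f (j + i) -
      ∑ i ∈ Finset.range N, ((i + (k + 1)).choose (k + 1) : R) * f i := by
  have h1 : ∑ i ∈ Finset.range N, ((i + (k + 1)).choose (k + 1) : R) * f i =
      ∑ i ∈ Finset.range N, ((i + k).choose k : R) * ∑ j ∈ Finset.range (N - i), f (j + i) := by
    simp only [Finset.mul_sum]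
    rw [← Finset.sum_range_diag_flip N fun i j => ((i + k).choose k : R) * f (j + i)]
    refine Finset.sum_congr rfl fun l _ => ?_
    rw [← add_assoc, ← Nat.sum_range_add_choose, Nat.cast_sum, Finset.sum_mul]
    refine Finset.sum_congr rfl fun i hi => ?_
    rw [Nat.sub_add_cancel (by simpa [Nat.lt_succ_iff] using hi)]
  rw [Finset.sum_comm, h1, ← Finset.sum_sub_distrib]
  refine Finset.dvd_sum fun i hi => ?_
  rw [← Finset.mul_sum, ← mul_sub, ← Finset.sum_Ico_eq_sub _ (Nat.sub_le N i)]
  refine (Finset.dvd_sum fun j hj => hf _ ?_).mul_left _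
  rw [Finset.mem_Ico] at hj
  omega

/-- Each merge replaces two ranks by the nonnegative rank `|m 0| + |m 1| + 2 * j + 1`, so the sum of
absolute values changes only by `2 * j + 1`, and one more free summation index raises the binomial
by one level. -/
theorem chainSeries_eq (D N k : ℕ) {L : ℕ} (hL : 0 < L) (hLD : L ≤ D) (m : Fin (k + 2) → ℤ) :
    (X : PowerSeries ℤ) ^ N ∣ chainSeries D (k + 1) L m - ∑ j ∈ Finset.range N,
      ((j + k).choose k : PowerSeries ℤ) *
        intervalSeries L D ((∑ i, |m i|) + 2 * j + (k + 1)) := by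
  induction k with
  | zero => simpa [Fin.sum_univ_two, chainSeries] using chainSeries_merge D N 0 hL hLD m
  | succ k ih =>
    have h1 := chainSeries_merge D N (k + 1) hL hLD m
    have h2 : (X : PowerSeries ℤ) ^ N ∣ ∑ j ∈ Finset.range N, (_ - _) :=
      Finset.dvd_sum fun j _ => ih
        (Fin.cons (|m 0| + |m 1| + 2 * (j : ℤ) + 1) (Fin.tail (Fin.tail m)))
    have h3 := sum_range_mul_choose_mod ((X : PowerSeries ℤ) ^ N) k N
      (fun i => intervalSeries L D ((∑ i, |m i|) + 2 * i + (k + 1 + 1))) fun i hi => by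
        refine X_pow_dvd_intervalSeries hL (le_trans ?_ (le_abs_self _))
        have h0 : 0 ≤ ∑ i, |m i| := Finset.sum_nonneg fun i _ => abs_nonneg (m i)
        have hi' : (N : ℤ) ≤ i := by exact_mod_cast hi
        linarith [Int.natCast_nonneg k]
    have h := (h1.add h2).add h3
    convert h using 1
    rw [Finset.sum_sub_distrib]
    have hsum : ∀ j i : ℕ, (∑ l, |(Fin.cons (|m 0| + |m 1| + 2 * (j : ℤ) + 1)
        (Fin.tail (Fin.tail m)) : Fin (k + 2) → ℤ) l|) + 2 * (i : ℤ) + (k + 1) =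
        (∑ i, |m i|) + 2 * ((j + i : ℕ) : ℤ) + (k + 1 + 1) := by
      intro j i
      rw [Fin.sum_univ_succ, Fin.sum_univ_succ (n := k + 2), Fin.sum_univ_succ (n := k + 1)]
      simp only [Fin.cons_zero, Fin.cons_succ, Fin.tail, Fin.succ_zero_eq_one]
      rw [abs_of_nonneg (by positivity)]
      push_cast
      ring
    simp only [hsum]
    push_cast
    ring

/-! ### Marked Durfee symbols as chains -/

theorem Multiset.sup_mem_of_ne_zero {s : Multiset ℕ} (h : s ≠ 0) : s.sup ∈ s := by
  induction s using Multiset.induction_on with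
  | empty => exact absurd rfl h
  | cons a s ih =>
    rw [Multiset.sup_cons]
    rcases max_choice a s.sup with h' | h' <;> rw [h']
    · exact Multiset.mem_cons_self _ _
    · by_cases hs : s = 0
      · subst hs
        simp_all
      · exact Multiset.mem_cons_of_mem (ih hs)

/-- Sequences of `k + 1` vectors with ranks `m i` as in a marked Durfee symbol, all of whose parts
lie in `[L, D)`. -/
def markedChains (D : ℕ) : (k : ℕ) → ℕ → (Fin (k + 1) → ℤ) →
    Set (Fin (k + 1) → Multiset ℕ × Multiset ℕ)
  | 0, L, m => {f | f 0 ∈ partitionPairs (Finset.Ico L D) (Finset.Ico L D) (m 0)}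
  | k + 1, L, m => {f | f 0 ∈ partitionPairs (Finset.Ico L D) (Finset.Ico L D) (m 0 + 1) ∧
      ((f 0).1 ≠ 0 ∧ (f 0).2.sup ≤ (f 0).1.sup) ∧
      Fin.tail f ∈ markedChains D k (f 0).1.sup (Fin.tail m)}

/-- Sort by the largest part `M` of the first top partition and remove one copy of it: the remaining
first pair is arbitrary with parts in `[L, M]`, and the other vectors form a chain with lower bound
`M`. -/
theorem hasGenFun_markedChains (D k : ℕ) {L : ℕ} (hL : 0 < L) (m : Fin (k + 1) → ℤ) :
    HasGenFun (markedChains D k L m) (fun f => ∑ i, pairWeight (f i)) (chainSeries D k L m) := by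
  induction k generalizing L with
  | zero =>
    have h : HasGenFun _ _ (intervalSeries L D (m 0)) :=
      hasGenFun_pairSeries (by simp; omega) (by simp; omega) (m 0)
    have h' := h.bijOn (f := fun p (_ : Fin 1) => p) (t := markedChains D 0 L m)
      (v := fun f => ∑ i, pairWeight (f i)) ⟨fun p hp => hp, ?_, ?_⟩ 0 (by simp)
    · simpa [chainSeries] using h'
    · intro p _ q _ hpq
      exact congrFun hpq 0
    · intro f hf
      exact ⟨f 0, hf, funext fun i => by rw [Subsingleton.elim i 0]⟩
  | succ k ih =>
    have hset : markedChains D (k + 1) L m =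
        {f ∈ markedChains D (k + 1) L m | (f 0).1.sup ∈ Finset.Ico L D} :=
      Set.ext fun f => ⟨fun hf => ⟨hf, hf.1.1 _ (Multiset.sup_mem_of_ne_zero hf.2.1.1)⟩, And.left⟩
    rw [hset, chainSeries]
    refine HasGenFun.sum_fiber _ _ _ fun M hM => ?_
    rw [Finset.mem_Ico] at hM
    have h : HasGenFun _ _ (intervalSeries L (M + 1) (m 0)) :=
      hasGenFun_pairSeries (by simp; omega) (by simp; omega) (m 0)
    refine (h.prod (ih (L := M) (by omega) (Fin.tail m))).bijOn
      (f := fun z => (Fin.cons (M ::ₘ z.1.1, z.1.2) z.2 :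
        Fin (k + 2) → Multiset ℕ × Multiset ℕ)) ⟨?_, ?_, ?_⟩ M ?_
    · rintro ⟨⟨α, β⟩, f⟩ ⟨⟨hα, hβ, hm⟩, hf⟩
      simp only [Finset.mem_Ico] at hα hβ hm
      have hsup : (M ::ₘ α).sup = M := by
        rw [Multiset.sup_cons]
        exact max_eq_left (Multiset.sup_le.2 fun x hx => by have := hα x hx; omega)
      refine ⟨⟨⟨?_, ?_, ?_⟩, ⟨?_, ?_⟩, ?_⟩, hsup⟩
      · intro x hx
        simp only [Fin.cons_zero, Multiset.mem_cons] at hx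
        rw [Finset.mem_Ico]
        rcases hx with rfl | hx
        · exact hM
        · have := hα x hx
          omega
      · intro x hx
        have := hβ x hx
        rw [Finset.mem_Ico]
        omega
      · simp only [Fin.cons_zero, Multiset.card_cons]
        push_cast
        omega
      · simp
      · simp only [Fin.cons_zero, hsup]
        exact Multiset.sup_le.2 fun x hx => by have := hβ x hx; omega
      · simp only [Fin.cons_zero, hsup, Fin.tail_cons]
        exact hf
    · rintro ⟨⟨α, β⟩, f⟩ _ ⟨⟨α', β'⟩, f'⟩ _ h
      rw [Fin.cons_inj] at h
      simp only [Prod.mk.injEq, Multiset.cons_inj_right] at h ⊢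
      exact h
    · rintro f ⟨⟨⟨hα, hβ, hm⟩, ⟨hne, hle⟩, hf⟩, rfl⟩
      obtain ⟨α, hα'⟩ := Multiset.exists_cons_of_mem (Multiset.sup_mem_of_ne_zero hne)
      refine ⟨((α, (f 0).2), Fin.tail f), ⟨⟨?_, ?_, ?_⟩, hf⟩, ?_⟩
      · intro x hx
        have hx' : x ∈ (f 0).1 := hα' ▸ Multiset.mem_cons_of_mem hx
        have := hα x hx'
        have := Multiset.le_sup hx'
        simp only [Finset.mem_Ico] at *
        omega
      · intro x hx
        have := hβ x hx
        have := Multiset.le_sup hx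
        simp only [Finset.mem_Ico] at *
        omega
      · rw [hα', Multiset.card_cons] at hm
        push_cast at hm
        simp only
        omega
      · simp only [← hα']
        exact Fin.cons_self_tail f
    · rintro ⟨⟨α, β⟩, f⟩ _
      simp [Fin.sum_univ_succ, pairWeight]
      ring

theorem mem_markedChains_iff (D k L : ℕ) (m : Fin (k + 1) → ℤ)
    (f : Fin (k + 1) → Multiset ℕ × Multiset ℕ) :
    f ∈ markedChains D k L m ↔
      (∀ i, f i ∈ partitionPairs (Finset.Ico L D) (Finset.Ico L D)
        (m i + if (i : ℕ) + 1 < k + 1 then 1 else 0)) ∧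
      (∀ i : Fin (k + 1), (i : ℕ) + 1 < k + 1 → (f i).1 ≠ 0 ∧ (f i).2.sup ≤ (f i).1.sup) ∧
      ∀ i j : Fin (k + 1), (j : ℕ) = (i : ℕ) + 1 →
        (∀ x ∈ (f j).1, (f i).1.sup ≤ x) ∧ ∀ x ∈ (f j).2, (f i).1.sup ≤ x := by
  induction k generalizing L with
  | zero =>
    constructor
    · intro hf
      refine ⟨fun i => ?_, fun i hi => by omega, fun i j hij => by omega⟩
      rw [show i = 0 from Subsingleton.elim (α := Fin 1) i 0]
      simpa [markedChains] using hf
    · rintro ⟨h, -, -⟩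
      simpa [markedChains] using h 0
  | succ k ih =>
    simp only [markedChains, Set.mem_ofPred_eq, ih]
    constructor
    · rintro ⟨h0, hne, h1, h2, h3⟩
      have hsup := h0.1 _ (Multiset.sup_mem_of_ne_zero hne.1)
      rw [Finset.mem_Ico] at hsup
      refine ⟨fun i => ?_, fun i => ?_, fun i j => ?_⟩
      · refine Fin.cases ?_ (fun i => ?_) i
        · simpa using h0
        · obtain ⟨ha, hb, hc⟩ := h1 i
          refine ⟨fun x hx => ?_, fun x hx => ?_, ?_⟩
          · have := ha x hx
            rw [Finset.mem_Ico] at *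
            omega
          · have := hb x hx
            rw [Finset.mem_Ico] at *
            omega
          · simpa [Fin.tail] using hc
      · refine Fin.cases (fun _ => hne) (fun i hi => ?_) i
        exact h2 i (by simpa using hi)
      · refine Fin.cases (fun h => by simp at h) (fun j => ?_) j
        refine Fin.cases (fun h => ?_) (fun i h => ?_) i
        · exact ⟨fun x hx => (Finset.mem_Ico.1 ((h1 j).1 x hx)).1,
            fun x hx => (Finset.mem_Ico.1 ((h1 j).2.1 x hx)).1⟩
        · exact h3 i j (by simpa using h)
    · rintro ⟨h1, h2, h3⟩
      -- The symbol bounds only neighbouring vectors. The bound by the first maximum propagates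
      -- because each intermediate top partition is non-empty, so its maximum is one of its own
      -- parts.
      have hbound : ∀ i : Fin (k + 1), (∀ x ∈ (f i.succ).1, (f 0).1.sup ≤ x) ∧
          ∀ x ∈ (f i.succ).2, (f 0).1.sup ≤ x := by
        intro i
        induction i using Fin.induction with
        | zero => exact h3 0 1 (by simp)
        | succ i ihi =>
          have hne := (h2 i.castSucc.succ (by simp)).1
          have hle := ihi.1 _ (Multiset.sup_mem_of_ne_zero hne)
          have h := h3 i.castSucc.succ i.succ.succ (by simp)
          exact ⟨fun x hx => hle.trans (h.1 x hx), fun x hx => hle.trans (h.2 x hx)⟩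
      refine ⟨by simpa using h1 0, h2 0 (by simp), fun i => ?_, fun i hi => ?_, fun i j hij => ?_⟩
      · obtain ⟨ha, hb, hc⟩ := h1 i.succ
        refine ⟨fun x hx => ?_, fun x hx => ?_, ?_⟩
        · exact Finset.mem_Ico.2 ⟨(hbound i).1 x hx, (Finset.mem_Ico.1 (ha x hx)).2⟩
        · exact Finset.mem_Ico.2 ⟨(hbound i).2 x hx, (Finset.mem_Ico.1 (hb x hx)).2⟩
        · simpa [Fin.tail] using hc
      · exact h2 i.succ (by simpa using hi)
      · exact h3 i.succ j.succ (by simpa using hij)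

theorem markedDurfeeSymbols_finite_and_ncard (k : ℕ) (m : Fin (k + 1) → ℤ) (n : ℕ) :
    (markedDurfeeSymbols (k + 1) m n).Finite ∧
      ((markedDurfeeSymbols (k + 1) m n).ncard : ℤ) =
        ∑ d ∈ Finset.range (n + 1), coeff n (X ^ (d ^ 2) * chainSeries (d + 1) k 1 m) := by
  obtain ⟨hfin, hcard⟩ :=
    HasGenFun.sigma_sq (fun d => hasGenFun_markedChains (d + 1) k one_pos m) n
  set T := {z : ℕ × (Fin (k + 1) → Multiset ℕ × Multiset ℕ) |
    z.2 ∈ markedChains (z.1 + 1) k 1 m ∧ ∑ i, pairWeight (z.2 i) + z.1 ^ 2 = n} with hT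
  have hbij : Set.BijOn (fun η : MarkedDurfeeSymbol (k + 1) => (η.D, fun i => (η.top i, η.bot i)))
      (markedDurfeeSymbols (k + 1) m n) T := by
    refine ⟨?_, ?_, ?_⟩
    · rintro η ⟨hw, hr⟩
      refine ⟨(mem_markedChains_iff _ _ _ _ _).2 ⟨fun i => ⟨fun x hx => ?_, fun x hx => ?_, ?_⟩,
        fun i hi => ⟨η.top_nonempty i hi, η.bot_le_top i hi⟩, fun i j hij =>
        ⟨η.top_le_top_succ i j hij, η.top_le_bot_succ i j hij⟩⟩, hw⟩
      · exact Finset.mem_Ico.2 ⟨η.top_pos i x hx, Nat.lt_succ_of_le (η.top_le_D i x hx)⟩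
      · exact Finset.mem_Ico.2 ⟨η.bot_pos i x hx, Nat.lt_succ_of_le (η.bot_le_D i x hx)⟩
      · rw [← hr i, MarkedDurfeeSymbol.rank]
        ring
    · rintro η _ η' _ h
      simp only [Prod.mk.injEq, funext_iff] at h
      exact MarkedDurfeeSymbol.ext (funext fun i => (h.2 i).1) (funext fun i => (h.2 i).2) h.1
    · rintro ⟨d, f⟩ ⟨hf, hw⟩
      obtain ⟨h1, h2, h3⟩ := (mem_markedChains_iff _ _ _ _ _).1 hf
      refine ⟨⟨fun i => (f i).1, fun i => (f i).2, d,
        fun i x hx => (Finset.mem_Ico.1 ((h1 i).1 x hx)).1,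
        fun i x hx => (Finset.mem_Ico.1 ((h1 i).2.1 x hx)).1,
        fun i hi => (h2 i hi).1, fun i hi => (h2 i hi).2,
        fun i j hij => (h3 i j hij).2, fun i j hij => (h3 i j hij).1,
        fun i x hx => Nat.lt_succ_iff.1 (Finset.mem_Ico.1 ((h1 i).1 x hx)).2,
        fun i x hx => Nat.lt_succ_iff.1 (Finset.mem_Ico.1 ((h1 i).2.1 x hx)).2⟩,
        ⟨hw, fun i => ?_⟩, rfl⟩
      simp only [MarkedDurfeeSymbol.rank]
      rw [(h1 i).2.2]
      ring
  rw [← hcard, ← hbij.image_eq, hbij.injOn.ncard_image]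
  exact ⟨Set.Finite.of_finite_image (hbij.image_eq ▸ hfin) hbij.injOn, rfl⟩

/-! ### Conjugation and Durfee squares -/

theorem Multiset.sup_map_add {t : Multiset ℕ} (ht : t ≠ 0) (c : ℕ) :
    (t.map (· + c)).sup = t.sup + c := by
  refine le_antisymm (Multiset.sup_le.2 fun x hx => ?_) ?_
  · obtain ⟨y, hy, rfl⟩ := Multiset.mem_map.1 hx
    exact Nat.add_le_add_right (Multiset.le_sup hy) c
  · exact Multiset.le_sup (Multiset.mem_map.2 ⟨_, Multiset.sup_mem_of_ne_zero ht, rfl⟩)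

theorem Multiset.map_sub_map_add {t : Multiset ℕ} {c : ℕ} (h : ∀ x ∈ t, c ≤ x) :
    (t.map (· - c)).map (· + c) = t := by
  rw [Multiset.map_map]
  conv_rhs => rw [← Multiset.map_id t]
  exact Multiset.map_congr rfl fun x hx => Nat.sub_add_cancel (h x hx)

/-- Conjugation: partitions with parts at most `d` correspond to multisets of `d` natural numbers,
and the number of parts to the largest element. -/
theorem exists_conjugation (d : ℕ) : ∃ φ : Multiset ℕ → Multiset ℕ,
    Set.BijOn φ {s | ∀ x ∈ s, x ∈ Finset.Ico 1 (d + 1)} {t | t.card = d} ∧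
      ∀ s, (∀ x ∈ s, x ∈ Finset.Ico 1 (d + 1)) → (φ s).sup = s.card ∧ (φ s).sum = s.sum := by
  induction d with
  | zero =>
    have hzero : {s : Multiset ℕ | ∀ x ∈ s, x ∈ Finset.Ico 1 (0 + 1)} = {0} := by
      ext s
      constructor
      · intro hs
        exact Multiset.eq_zero_of_forall_notMem fun x hx => by
          have := hs x hx
          simp at this
      · rintro rfl
        simp
    have hcard : {t : Multiset ℕ | t.card = 0} = {0} := by
      ext t
      simp
    refine ⟨id, ?_, fun s hs => ?_⟩
    · rw [hzero, hcard]
      exact Set.bijOn_id _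
    · have : s ∈ ({0} : Set (Multiset ℕ)) := hzero ▸ hs
      rw [Set.mem_singleton_iff] at this
      subst this
      simp
  | succ d ih =>
    obtain ⟨φ, hφ, hstat⟩ := ih
    have hfilter : ∀ s : Multiset ℕ, (∀ x ∈ s, x ∈ Finset.Ico 1 (d + 1 + 1)) →
        ∀ x ∈ s.filter (d + 1 ≠ ·), x ∈ Finset.Ico 1 (d + 1) := by
      intro s hs x hx
      rw [Multiset.mem_filter] at hx
      have := hs x hx.1
      rw [Finset.mem_Ico] at *
      omega
    have hsplit : ∀ s : Multiset ℕ,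
        Multiset.replicate (s.count (d + 1)) (d + 1) + s.filter (d + 1 ≠ ·) = s := by
      intro s
      rw [← Multiset.filter_eq]
      exact Multiset.filter_add_not _ s
    have hmin : ∀ (c : ℕ) (t : Multiset ℕ), ∀ x ∈ (0 ::ₘ t).map (· + c), c ≤ x := by
      intro c t x hx
      obtain ⟨y, -, rfl⟩ := Multiset.mem_map.1 hx
      omega
    have hmem : ∀ (c : ℕ) (t : Multiset ℕ), c ∈ (0 ::ₘ t).map (· + c) := by
      intro c t
      simp
    -- Each part `d + 1` is a column of full height and adds one to all `d + 1` rows; the remaining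
    -- parts never reach the last row, which contributes the `0`. The number of full columns is
    -- recovered as the smallest row.
    refine ⟨fun s => (0 ::ₘ φ (s.filter (d + 1 ≠ ·))).map (· + s.count (d + 1)),
      ⟨fun s hs => ?_, fun s hs s' hs' h => ?_, fun t ht => ?_⟩, fun s hs => ?_⟩
    · have := hφ.mapsTo (hfilter s hs)
      simpa using this
    · simp only at h
      have hc : s.count (d + 1) = s'.count (d + 1) :=
        le_antisymm (hmin _ _ _ (h ▸ hmem (s'.count (d + 1)) _))
          (hmin _ _ _ (h ▸ hmem (s.count (d + 1)) _))
      rw [hc] at h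
      have h' := Multiset.map_injective (add_left_injective _) h
      rw [Multiset.cons_inj_right] at h'
      rw [← hsplit s, ← hsplit s', hc, hφ.injOn (hfilter s hs) (hfilter s' hs') h']
    · have hne : ∃ c, c ∈ t := Multiset.card_pos_iff_exists_mem.1 (by
        simp only [Set.mem_ofPred_eq] at ht
        omega)
      classical
      have hle : ∀ x ∈ t, Nat.find hne ≤ x := fun x hx => Nat.find_min' hne hx
      have hc := Nat.find_spec hne
      generalize Nat.find hne = c at hle hc
      have h0 : 0 ∈ t.map (· - c) := Multiset.mem_map.2 ⟨c, hc, by simp⟩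
      obtain ⟨u, hu⟩ := Multiset.exists_cons_of_mem h0
      have hucard : u.card = d := by
        have := congrArg Multiset.card hu
        simp only [Set.mem_ofPred_eq, Multiset.card_map, Multiset.card_cons] at this ht
        omega
      obtain ⟨s, hs, rfl⟩ := hφ.surjOn hucard
      have hs' : ∀ x ∈ s, x ≠ d + 1 := fun x hx => by
        have := hs x hx
        rw [Finset.mem_Ico] at this
        omega
      refine ⟨Multiset.replicate c (d + 1) + s, fun x hx => ?_, ?_⟩
      · rw [Multiset.mem_add, Multiset.mem_replicate] at hx
        rw [Finset.mem_Ico]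
        rcases hx with ⟨-, rfl⟩ | hx
        · omega
        · have := hs x hx
          rw [Finset.mem_Ico] at this
          omega
      · have h1 : (Multiset.replicate c (d + 1) + s).count (d + 1) = c := by
          rw [Multiset.count_add, Multiset.count_replicate_self,
            Multiset.count_eq_zero_of_notMem fun h => hs' _ h rfl, add_zero]
        have h2 : (Multiset.replicate c (d + 1) + s).filter (d + 1 ≠ ·) = s := by
          rw [Multiset.filter_add, Multiset.filter_eq_nil.2, zero_add, Multiset.filter_eq_self]
          · exact fun x hx => (hs' x hx).symm
          · intro x hx
            rw [Multiset.eq_of_mem_replicate hx]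
            simp
        simp only [h1, h2]
        rw [← hu, Multiset.map_sub_map_add hle]
    · obtain ⟨h1, h2⟩ := hstat _ (hfilter s hs)
      have hcard := congrArg Multiset.card (hsplit s)
      have hsum := congrArg Multiset.sum (hsplit s)
      have hφcard : (φ (s.filter (d + 1 ≠ ·))).card = d := hφ.mapsTo (hfilter s hs)
      simp only [Multiset.card_add, Multiset.card_replicate, Multiset.sum_add,
        Multiset.sum_replicate, smul_eq_mul] at hcard hsum
      beta_reduce
      generalize s.count (d + 1) = c at *
      constructor
      · rw [Multiset.sup_map_add (by simp), Multiset.sup_cons, h1, Nat.zero_max]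
        omega
      · rw [Multiset.sum_map_add]
        simp only [Multiset.map_id', Multiset.sum_cons, h2, Multiset.map_const',
          Multiset.card_cons, hφcard, Multiset.sum_replicate, smul_eq_mul]
        linarith

/-- Every partition splits uniquely into the rows meeting its Durfee square and the rows below. -/
theorem exists_durfee (s : Multiset ℕ) : ∃ (d : ℕ) (t u : Multiset ℕ), t + u = s ∧ t.card = d ∧
    (∀ x ∈ t, d ≤ x) ∧ ∀ x ∈ u, x ≤ d := by
  classical
  -- The Durfee side is the least `d` with at most `d` parts exceeding `d`.
  have hex : ∃ d, s.countP (d < ·) ≤ d := ⟨s.card, Multiset.countP_le_card _ _⟩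
  have hd := Nat.find_spec hex
  have hmin := fun e => Nat.find_min hex (m := e)
  generalize Nat.find hex = d at hd hmin
  -- By minimality at least `d` parts are `≥ d`, so there are enough copies of `d` to pad the larger
  -- parts to exactly `d` rows.
  have hcount : d ≤ s.countP (d < ·) + (s.filter (¬ d < ·)).count d := by
    cases d with
    | zero => exact Nat.zero_le _
    | succ e =>
      have he := hmin e (Nat.lt_succ_self e)
      rw [Multiset.countP_eq_countP_filter_add s (e < ·) (e + 1 < ·)] at he
      have h1 : (s.filter (e + 1 < ·)).countP (e < ·) ≤ s.countP (e + 1 < ·) := by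
        rw [Multiset.countP_eq_card_filter (e + 1 < ·)]
        exact Multiset.countP_le_card _ _
      have h2 : (s.filter (¬ e + 1 < ·)).countP (e < ·) = (s.filter (¬ e + 1 < ·)).count (e + 1) := by
        rw [Multiset.count]
        refine Multiset.countP_congr rfl fun x hx => ?_
        rw [Multiset.mem_filter] at hx
        simp only [eq_iff_iff]
        omega
      omega
  have hle : Multiset.replicate (d - s.countP (d < ·)) d ≤ s.filter (¬ d < ·) := by
    rw [← Multiset.le_count_iff_replicate_le]
    omega
  refine ⟨d, s.filter (d < ·) + Multiset.replicate (d - s.countP (d < ·)) d,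
    s.filter (¬ d < ·) - Multiset.replicate (d - s.countP (d < ·)) d, ?_, ?_, ?_, ?_⟩
  · rw [add_assoc, add_tsub_cancel_of_le hle, Multiset.filter_add_not]
  · rw [Multiset.card_add, Multiset.card_replicate, ← Multiset.countP_eq_card_filter]
    omega
  · intro x hx
    rw [Multiset.mem_add, Multiset.mem_filter, Multiset.mem_replicate] at hx
    omega
  · intro x hx
    have := (Multiset.mem_filter.1 (Multiset.mem_of_le tsub_le_self hx)).2
    omega

/-- The Durfee square of a partition determines its upper part. -/
theorem durfee_unique {t u t' u' : Multiset ℕ} (h : t + u = t' + u')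
    (ht : ∀ x ∈ t, t.card ≤ x) (hu : ∀ x ∈ u, x ≤ t.card)
    (ht' : ∀ x ∈ t', t'.card ≤ x) (hu' : ∀ x ∈ u', x ≤ t'.card) : t = t' := by
  have key : ∀ {t u t' u' : Multiset ℕ}, t + u = t' + u' → (∀ x ∈ t, t.card ≤ x) →
      (∀ x ∈ u, x ≤ t.card) → (∀ x ∈ t', t'.card ≤ x) → t'.card ≤ t.card := by
    intro t u t' u' h ht hu ht'
    by_contra! hlt
    have h1 : (t + u).countP (t.card < ·) ≤ t.card := by
      rw [Multiset.countP_add, Multiset.countP_eq_zero.2 fun x hx => (hu x hx).not_gt]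
      exact Multiset.countP_le_card _ _
    have h2 : t'.countP (t.card < ·) = t'.card :=
      Multiset.countP_eq_card.2 fun x hx => hlt.trans_le (ht' x hx)
    rw [h, Multiset.countP_add] at h1
    omega
  have hcard : t.card = t'.card := le_antisymm (key h.symm ht' hu' ht) (key h ht hu ht')
  -- The upper part is forced: all parts exceeding `d`, padded with copies of `d` to `d` rows.
  have hform : ∀ {t u : Multiset ℕ} {d : ℕ}, t.card = d → (∀ x ∈ t, d ≤ x) → (∀ x ∈ u, x ≤ d) →
      t = (t + u).filter (d < ·) + Multiset.replicate (d - ((t + u).filter (d < ·)).card) d := by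
    intro t u d hd ht hu
    have hf : (t + u).filter (d < ·) = t.filter (d < ·) := by
      rw [Multiset.filter_add, (Multiset.filter_eq_nil (s := u)).2 fun x hx => (hu x hx).not_gt,
        add_zero]
    have hrest : t.filter (¬ d < ·) = Multiset.replicate (t.filter (¬ d < ·)).card d :=
      Multiset.eq_replicate_card.2 fun x hx => by
        rw [Multiset.mem_filter] at hx
        have := ht x hx.1
        omega
    have hsplit : t.filter (d < ·) + t.filter (¬ d < ·) = t := Multiset.filter_add_not _ t
    have hc := congrArg Multiset.card hsplit
    rw [Multiset.card_add, hd] at hc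
    rw [hf, show d - (t.filter (d < ·)).card = (t.filter (¬ d < ·)).card by omega, ← hrest, hsplit]
  rw [hform rfl ht hu, hform rfl ht' hu', ← hcard, h]

theorem sup_durfee {d : ℕ} {t u : Multiset ℕ} (ht : t.card = d) (hu : ∀ x ∈ u, x ≤ d) :
    (t.map (· + d) + u).sup = t.sup + d := by
  rw [Multiset.sup_add]
  have hu' : u.sup ≤ d := Multiset.sup_le.2 hu
  by_cases h : t = 0
  · subst h
    simp only [Multiset.card_zero] at ht
    subst ht
    simpa using hu'
  · rw [Multiset.sup_map_add h]
    exact max_eq_left (by omega)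

/-! ### Ranks of partitions and the conclusion -/

theorem rankCount_eq_ncard (m : ℤ) (n : ℕ) :
    rankCount m n = {s : Multiset ℕ |
      (∀ x ∈ s, 0 < x) ∧ s.sum = n ∧ (s.sup : ℤ) - s.card = m}.ncard := by
  rw [rankCount, ← Set.ncard_coe_finset, ← Set.InjOn.ncard_image
    (f := fun p : Nat.Partition n => p.parts) fun p _ q _ h => Nat.Partition.ext h]
  congr 1
  ext s
  simp only [Finset.coe_filter, Finset.mem_univ, true_and, Set.mem_image, Set.mem_ofPred_eq]
  constructor
  · rintro ⟨p, hp, rfl⟩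
    exact ⟨fun x hx => p.parts_pos hx, p.parts_sum, hp⟩
  · rintro ⟨hpos, hsum, hr⟩
    exact ⟨⟨s, fun {i} hi => hpos i hi, hsum⟩, hr, rfl⟩

/-- The largest part is `d` plus the number of parts of the conjugated right piece, and the number
of parts is `d` plus that of the lower piece, so `d` cancels in the rank. -/
theorem rankCount_eq_sum (m : ℤ) (n : ℕ) :
    (rankCount m n : ℤ) =
      ∑ d ∈ Finset.range (n + 1), coeff n (X ^ (d ^ 2) * intervalSeries 1 (d + 1) m) := by
  choose φ hφ hstat using exists_conjugation
  obtain ⟨-, hcard⟩ := HasGenFun.sigma_sq (fun d => hasGenFun_pairSeries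
    (A := Finset.Ico 1 (d + 1)) (B := Finset.Ico 1 (d + 1)) (by simp) (by simp) m) n
  simp only [intervalSeries]
  rw [← hcard, rankCount_eq_ncard, Nat.cast_inj]
  symm
  have hbound : ∀ {d : ℕ} {s : Multiset ℕ}, (∀ x ∈ s, x ∈ Finset.Ico 1 (d + 1)) → ∀ x ∈ s, x ≤ d :=
    fun h x hx => Nat.lt_succ_iff.1 (Finset.mem_Ico.1 (h x hx)).2
  have hge : ∀ (d : ℕ) (t : Multiset ℕ), ∀ x ∈ t.map (· + d), d ≤ x := by
    intro d t x hx
    obtain ⟨y, -, rfl⟩ := Multiset.mem_map.1 hx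
    omega
  refine Set.ncard_congr (fun z _ => (φ z.1 z.2.1).map (· + z.1) + z.2.2) ?_ ?_ ?_
  · rintro ⟨d, α, β⟩ ⟨⟨hα, hβ, hm⟩, hw⟩
    have hφc : (φ d α).card = d := (hφ d).mapsTo hα
    obtain ⟨h1, h2⟩ := hstat d α hα
    refine ⟨fun x hx => ?_, ?_, ?_⟩
    · rw [Multiset.mem_add] at hx
      rcases hx with hx | hx
      · dsimp only at hx
        have := hge _ _ x hx
        -- An element of the upper piece forces `d > 0`, and that element is at least `d`.
        have := Multiset.card_pos_iff_exists_mem.2 ⟨x, hx⟩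
        rw [Multiset.card_map] at this
        omega
      · exact (Finset.mem_Ico.1 (hβ x hx)).1
    · simp only [pairWeight] at hw
      rw [Multiset.sum_add, Multiset.sum_map_add]
      simp only [Multiset.map_id', h2, Multiset.map_const', hφc, Multiset.sum_replicate,
        smul_eq_mul]
      linarith
    · rw [sup_durfee hφc (hbound hβ), h1, Multiset.card_add, Multiset.card_map, hφc]
      push_cast
      simp only at hm
      omega
  · rintro ⟨d, α, β⟩ ⟨d', α', β'⟩ ⟨⟨hα, hβ, -⟩, -⟩ ⟨⟨hα', hβ', -⟩, -⟩ h
    simp only at h hα hβ hα' hβ'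
    have hc : ((φ d α).map (· + d)).card = d := by
      rw [Multiset.card_map]
      exact (hφ d).mapsTo hα
    have hc' : ((φ d' α').map (· + d')).card = d' := by
      rw [Multiset.card_map]
      exact (hφ d').mapsTo hα'
    have ht := durfee_unique h (by rw [hc]; exact hge _ _) (by rw [hc]; exact hbound hβ)
      (by rw [hc']; exact hge _ _) (by rw [hc']; exact hbound hβ')
    have hd : d = d' := by rw [← hc, ← hc', ht]
    subst hd
    rw [ht] at h
    rw [add_left_cancel h, (hφ d).injOn hα hα' (Multiset.map_injective (add_left_injective d) ht)]
  · rintro s ⟨hpos, hsum, hr⟩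
    obtain ⟨d, t, u, rfl, hc, ht, hu⟩ := exists_durfee s
    obtain ⟨α, hα, hαt⟩ := (hφ d).surjOn (show t.map (· - d) ∈ {t | t.card = d} by simpa using hc)
    have ht' : (φ d α).map (· + d) = t := by rw [hαt, Multiset.map_sub_map_add ht]
    have hφc : (φ d α).card = d := (hφ d).mapsTo hα
    obtain ⟨h1, h2⟩ := hstat d α hα
    have hu' : ∀ x ∈ u, x ∈ Finset.Ico 1 (d + 1) := fun x hx =>
      Finset.mem_Ico.2 ⟨hpos x (by simp [hx]), Nat.lt_succ_of_le (hu x hx)⟩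
    refine ⟨(d, α, u), ⟨⟨hα, hu', ?_⟩, ?_⟩, by simp [ht']⟩
    · rw [← ht', sup_durfee hφc hu, h1, Multiset.card_add, Multiset.card_map, hφc] at hr
      push_cast at hr
      simp only
      omega
    · rw [← ht', Multiset.sum_add, Multiset.sum_map_add] at hsum
      simp only [Multiset.map_id', h2, Multiset.map_const', hφc, Multiset.sum_replicate,
        smul_eq_mul] at hsum
      simp only [pairWeight]
      linarith

theorem rankCount_eq_zero {m : ℤ} {n : ℕ} (h : (n : ℤ) < m) : rankCount m n = 0 := by
  rw [← Nat.cast_inj (R := ℤ), rankCount_eq_sum]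
  refine Finset.sum_eq_zero fun d _ => ?_
  refine X_pow_dvd_iff.1 ((X_pow_dvd_intervalSeries (N := n + 1) one_pos ?_).mul_left _) n (by omega)
  exact le_trans (by push_cast; omega) (le_abs_self m)

theorem theorem1p3 (k : ℕ) (hk : 2 ≤ k) (m : Fin k → ℤ) (n : ℕ) :
    (markedDurfeeSymbols k m n).Finite ∧
    (Function.support fun j : ℕ => (j + k - 2).choose (k - 2) *
      rankCount ((∑ i, |m i|) + 2 * (j : ℤ) + (k : ℤ) - 1) n).Finite ∧
    (markedDurfeeSymbols k m n).ncard =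
      ∑ᶠ j : ℕ, (j + k - 2).choose (k - 2) *
        rankCount ((∑ i, |m i|) + 2 * (j : ℤ) + (k : ℤ) - 1) n := by
  obtain ⟨k, rfl⟩ := Nat.exists_eq_add_of_le' hk
  have hsub : (Function.support fun j : ℕ => (j + (k + 2) - 2).choose (k + 2 - 2) *
      rankCount ((∑ i, |m i|) + 2 * (j : ℤ) + ((k + 2 : ℕ) : ℤ) - 1) n) ⊆
        (Finset.range (n + 1) : Set ℕ) := by
    intro j hj
    rw [Function.mem_support] at hj
    by_contra hjn
    refine hj (mul_eq_zero_of_right _ (rankCount_eq_zero ?_))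
    have h0 : 0 ≤ ∑ i, |m i| := Finset.sum_nonneg fun i _ => abs_nonneg (m i)
    simp only [Finset.coe_range, Set.mem_Iio, not_lt] at hjn
    push_cast
    omega
  obtain ⟨hfin, hcard⟩ := markedDurfeeSymbols_finite_and_ncard (k + 1) m n
  refine ⟨hfin, (Finset.finite_toSet _).subset hsub, ?_⟩
  rw [finsum_eq_sum_of_support_subset _ hsub, ← Nat.cast_inj (R := ℤ), hcard]
  push_cast
  simp only [rankCount_eq_sum, Finset.mul_sum]
  rw [Finset.sum_comm]
  refine Finset.sum_congr rfl fun d _ => ?_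
  -- The subscript `d` allows parts in `[1, d + 1)`, and precision `X ^ (n + 1)` determines the
  -- coefficient of `X ^ n`.
  have h := (chainSeries_eq (d + 1) (n + 1) k one_pos (by omega) m).mul_left (X ^ (d ^ 2))
  have h' := X_pow_dvd_iff.1 h n (by omega)
  rw [mul_sub, map_sub, sub_eq_zero] at h'
  rw [h', Finset.mul_sum, map_sum]
  refine Finset.sum_congr rfl fun j _ => ?_
  rw [mul_left_comm, ← nsmul_eq_mul, map_nsmul, nsmul_eq_mul]
  rw [show j + (k + 2) - 2 = j + k by omega,
    show (∑ i, |m i|) + 2 * (j : ℤ) + ((k : ℤ) + 2) - 1 = (∑ i, |m i|) + 2 * j + (k + 1) by ring]
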